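/- Let $p$ be a prime, let $R$ be a (Noetherian) regular local ring of characteristic $p$, and let $S$ be an $R$-algebra that is a reduced local ring, meaning a reduced ring with a unique maximal ideal ($S$ is not required to be Noetherian). For a reduced ring $A$ of characteristic $p$ let $A_\infty$ denote its (minimal) perfect closure, and for $n\ge 0$ let $A_n=A^{1/p^n}=\{x\in A_\infty : x^{p^n}\in A\}$, so that $A_\infty=\bigcup_n A_n$; the map $R\to S$ induces ring homomorphisms $R_\infty\to S_\infty$ and $R_n\to S_n$. Assume that 1. $R\to S$ is generically étale with nonzero generic fibre, i.e. $S\otimes_R\mathrm{Frac}(R)$ is étale over $\mathrm{Frac}(R)$ and nonzero (equivalently, it is a nonempty finite product of finite separable field extensions of $\mathrm{Frac}(R)$); 2. $S_\infty$ is module-finite over $R_\infty$. Then there is an $N$ such that $R_n\to S_n$ is étale for all $n\ge N$. -/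

import Mathlib

open scoped TensorProduct

/-- The ring homomorphism `R_∞ → S_∞` induced by `R → S` on (minimal) perfect closures.
The perfect closure `A_∞` of a ring `A` of characteristic `p` is Mathlib's `PerfectClosure A p`,
the colimit of `A → A → A → ⋯` along the Frobenius endomorphism; when `A` is reduced it contains
`A` and it is the union of the rings `A ^ (1 / p ^ n)`. -/
noncomputable def perfectClosureMap (p : ℕ) [Fact p.Prime] (R S : Type*)
    [CommRing R] [CharP R p] [CommRing S] [CharP S p] [Algebra R S] :
    PerfectClosure R p →+* PerfectClosure S p :=
  PerfectClosure.lift R p (PerfectClosure S p)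
    ((PerfectClosure.of S p).comp (algebraMap R S))

/-- The induced map sends the image of `r : R` to the image of `algebraMap R S r`. -/
theorem perfectClosureMap_of (p : ℕ) [Fact p.Prime] (R S : Type*)
    [CommRing R] [CharP R p] [CommRing S] [CharP S p] [Algebra R S] (r : R) :
    perfectClosureMap p R S (PerfectClosure.of R p r) =
      PerfectClosure.of S p (algebraMap R S r) :=
  RingHom.congr_fun ((PerfectClosure.lift R p (PerfectClosure S p)).symm_apply_apply
    ((PerfectClosure.of S p).comp (algebraMap R S))) r

/-- `A_n = A ^ (1 / p ^ n)`: the subring of `A_∞` of all `x` such that `x ^ (p ^ n)` lies in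
(the image of) `A`. -/
def rootRing (p : ℕ) [Fact p.Prime] (A : Type*) [CommRing A] [CharP A p] (n : ℕ) :
    Subring (PerfectClosure A p) :=
  (PerfectClosure.of A p).range.comap (iterateFrobenius (PerfectClosure A p) p n)

theorem mem_rootRing {p : ℕ} [Fact p.Prime] {A : Type*} [CommRing A] [CharP A p] {n : ℕ}
    {x : PerfectClosure A p} :
    x ∈ rootRing p A n ↔ ∃ a : A, PerfectClosure.of A p a = x ^ p ^ n := by
  simp [rootRing, iterateFrobenius_def]

theorem perfectClosureMap_mem_rootRing (p : ℕ) [Fact p.Prime] (R S : Type*)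
    [CommRing R] [CharP R p] [CommRing S] [CharP S p] [Algebra R S] (n : ℕ)
    (x : PerfectClosure R p) (hx : x ∈ rootRing p R n) :
    perfectClosureMap p R S x ∈ rootRing p S n := by
  obtain ⟨a, ha⟩ := mem_rootRing.1 hx
  exact mem_rootRing.2 ⟨algebraMap R S a, by rw [← map_pow, ← ha, perfectClosureMap_of]⟩

/-- The ring homomorphism `R_n → S_n` obtained by restricting `R_∞ → S_∞`. -/
noncomputable def rootRingMap (p : ℕ) [Fact p.Prime] (R S : Type*)
    [CommRing R] [CharP R p] [CommRing S] [CharP S p] [Algebra R S] (n : ℕ) :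
    rootRing p R n →+* rootRing p S n :=
  (perfectClosureMap p R S).restrict (rootRing p R n) (rootRing p S n)
    (perfectClosureMap_mem_rootRing p R S n)

/-- `R → S` is generically étale: the generic fibre `Frac(R) ⊗_R S` is étale over `Frac(R)`.
(Used for a domain `R`, where `FractionRing R` is the field of fractions.) -/
def GenericallyEtale (R S : Type*) [CommRing R] [CommRing S] [Algebra R S] : Prop :=
  Algebra.Etale (FractionRing R) (FractionRing R ⊗[R] S)

/-!
The Frobenius of the regular ring `R` is flat (Kunz). If `L` is a separable algebraic extension of
the fraction field of `R`, it follows that every `R`-linear relation between `p`-th powers of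
elements of `L` is a combination of `p`-th powers of relations between these elements.

The generic fibre provides an `R`-algebra map `S → L` to such a field; let `A` be its image.
Finiteness of `S_∞` over `R_∞` makes `A` a finite `R`-module spanned by `p`-th powers, so `A` is
unramified over `R`. By Nakayama's lemma for the ideal generated by the coefficients of all
relations of a minimal generating family, `A` is free. Hence `A` is étale over `R`. Modulo
`p`-power roots, the kernel of `S → A` is generated in the same way by finitely many of its
elements; they lie in the maximal ideal and generate the kernel through arbitrarily high powers, so
Nakayama's lemma and reducedness show that the kernel vanishes. Thus `R → S` itself is étale, and
every `R_n → S_n` is isomorphic to `R → S`.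
-/

/-! ### The local criterion for flatness -/

section LocalCriterion

theorem isOka_forall_exists_extension (R E : Type*) [CommRing R] [AddCommGroup E] [Module R E] :
    Ideal.IsOka fun I : Ideal R ↦
      ∀ g : I →ₗ[R] E, ∃ g' : R →ₗ[R] E, ∀ x (hx : x ∈ I), g' x = g ⟨x, hx⟩ where
  top g := ⟨g ∘ₗ Submodule.topEquiv.symm.toLinearMap, fun _ _ ↦ rfl⟩
  oka {I a} extend_sup extend_colon g := by
    have mul_mem (c : I.colon (Ideal.span {a} : Ideal R)) : (c : R) * a ∈ I :=
      Ideal.mem_colon_span_singleton.1 c.2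
    obtain ⟨h, hh⟩ := extend_colon
      (g ∘ₗ ((LinearMap.mulRight R a).comp (Submodule.subtype _)).codRestrict I mul_mem)
    have h_eq (c : R) (hc : c * a ∈ I) : g ⟨c * a, hc⟩ = c • h 1 := by
      rw [← map_smul, smul_eq_mul, mul_one, hh c (Ideal.mem_colon_span_singleton.2 hc)]
      rfl
    let e : R →ₗ.[R] E := LinearPMap.mkSpanSingleton' a (h 1) fun c hc ↦ by
      have hca : c * a ∈ I := (show c * a = 0 from hc) ▸ I.zero_mem
      rw [RingHom.id_apply, ← h_eq c hca]
      exact (congrArg g (Subtype.ext hc)).trans g.map_zero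
    have compat (x : I) (y : e.domain) (hxy : (x : R) = y) : g x = e y := by
      obtain ⟨y, hy⟩ := y
      obtain ⟨c, rfl⟩ := Ideal.mem_span_singleton'.1 hy
      have hca : c * a ∈ I := (show (x : R) = c * a from hxy) ▸ x.2
      obtain rfl : x = ⟨c * a, hca⟩ := Subtype.ext hxy
      exact (h_eq c hca).trans
        (LinearPMap.mkSpanSingleton'_apply (σ := RingHom.id R) a (h 1) _ c hy).symm
    let f : R →ₗ.[R] E := ⟨I, g⟩
    obtain ⟨g', hg'⟩ := extend_sup (f.sup e compat).toFun
    refine ⟨g', fun x hx ↦ ?_⟩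
    rw [hg' x (Ideal.mem_sup_left hx)]
    refine (LinearPMap.sup_apply compat ⟨x, hx⟩ 0 _ (by simp)).trans ?_
    simp [f]

theorem flat_of_forall_isPrime_rTensor_injective {R M : Type*} [CommRing R] [IsNoetherianRing R]
    [AddCommGroup M] [Module R M]
    (h : ∀ P : Ideal R, P.IsPrime → Function.Injective (P.subtype.rTensor M)) :
    Module.Flat R M :=
  Module.Flat.iff_characterModule_baer.2 <|
    (isOka_forall_exists_extension R (CharacterModule M)).forall_of_forall_prime
      (fun _ hI ↦ exists_maximal_of_wellFoundedGT _ ⟨_, hI⟩) fun P hP g ↦ by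
        obtain ⟨g', rfl⟩ := rTensor_injective_iff_lcomp_surjective.1 (h P hP) g
        exact ⟨g', fun _ _ ↦ rfl⟩

variable {R : Type*} [CommRing R]

theorem rTensor_restrictScalars_injective_of_flat_baseChange {A M N N' : Type*} [CommRing A]
    [Algebra R A] [AddCommGroup M] [Module R M] [Module.Flat A (A ⊗[R] M)]
    [AddCommGroup N] [Module R N] [Module A N] [IsScalarTower R A N]
    [AddCommGroup N'] [Module R N'] [Module A N'] [IsScalarTower R A N']
    {f : N →ₗ[A] N'} (hf : Function.Injective f) :
    Function.Injective ((f.restrictScalars R).rTensor M) := by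
  let e := TensorProduct.AlgebraTensorModule.cancelBaseChange R A A N M
  let e' := TensorProduct.AlgebraTensorModule.cancelBaseChange R A A N' M
  have comm : (f.restrictScalars R).rTensor M = ⇑e' ∘ f.rTensor (A ⊗[R] M) ∘ ⇑e.symm := by
    rw [← Function.comp_assoc, LinearEquiv.eq_comp_symm]
    funext z
    induction z with
    | zero => simp
    | add y z hy hz => simp_all
    | tmul n z =>
      induction z with
      | zero => simp
      | add y z hy hz => simp_all [TensorProduct.tmul_add]
      | tmul a m => simp [e, e']
  rw [comm]
  exact e'.injective.comp ((Module.Flat.rTensor_preserves_injective_linearMap f hf).comp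
    e.symm.injective)

theorem mem_range_lTensor_of_exact {M N : Type*} [AddCommGroup M] [Module R M] [AddCommGroup N]
    [Module R N] {I 𝔞 : Ideal R} [Module.Flat (R ⧸ 𝔞) ((R ⧸ 𝔞) ⊗[R] M)] {g : N →ₗ[R] I}
    (hg : Function.Exact g (Algebra.linearMap R (R ⧸ 𝔞) ∘ₗ I.subtype)) {z : M ⊗[R] I}
    (hz : I.subtype.lTensor M z = 0) : z ∈ LinearMap.range (g.lTensor M) := by
  let J : Ideal (R ⧸ 𝔞) := I.map (Ideal.Quotient.mk 𝔞)
  let π : I →ₗ[R] J := (Algebra.linearMap R (R ⧸ 𝔞) ∘ₗ I.subtype).codRestrict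
    (J.restrictScalars R) fun x ↦ Ideal.mem_map_of_mem _ x.2
  have π_surjective : Function.Surjective π := by
    rintro ⟨y, hy⟩
    obtain ⟨x, hx, rfl⟩ := (Ideal.mem_map_iff_of_surjective _ Ideal.Quotient.mk_surjective).1 hy
    exact ⟨⟨x, hx⟩, rfl⟩
  have exact_π : Function.Exact g π := fun x ↦ Subtype.ext_iff.trans (hg x)
  have J_injective : Function.Injective ((J.subtype.restrictScalars R).lTensor M) :=
    (LinearMap.lTensor_inj_iff_rTensor_inj M _).2
      (rTensor_restrictScalars_injective_of_flat_baseChange J.injective_subtype)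
  refine (lTensor_exact M exact_π π_surjective z).1 (J_injective ?_)
  rw [map_zero, ← LinearMap.lTensor_comp_apply]
  have comm : J.subtype.restrictScalars R ∘ₗ π = Algebra.linearMap R (R ⧸ 𝔞) ∘ₗ I.subtype := rfl
  rw [comm, LinearMap.lTensor_comp_apply, hz, map_zero]

theorem lTensor_subtype_injective_of_mem {M : Type*} [AddCommGroup M] [Module R M] {I : Ideal R}
    {x : R} [Module.Flat (R ⧸ Ideal.span {x}) ((R ⧸ Ideal.span {x}) ⊗[R] M)]
    (hreg : IsSMulRegular M x) (hxI : x ∈ I) : Function.Injective (I.subtype.lTensor M) := by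
  rw [injective_iff_map_eq_zero]
  intro z hz
  let g : R →ₗ[R] I := LinearMap.toSpanSingleton R I ⟨x, hxI⟩
  have exact_g : Function.Exact g (Algebra.linearMap R (R ⧸ Ideal.span {x}) ∘ₗ I.subtype) :=
    fun _ ↦ (Ideal.Quotient.eq_zero_iff_mem.trans Ideal.mem_span_singleton').trans
      (exists_congr fun _ ↦ ⟨fun h ↦ Subtype.ext h, congrArg Subtype.val⟩)
  have subtype_comp_g : I.subtype ∘ₗ g = x • LinearMap.id := by ext; simp [g]
  obtain ⟨w, rfl⟩ := mem_range_lTensor_of_exact exact_g hz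
  rw [← LinearMap.lTensor_comp_apply, subtype_comp_g, LinearMap.lTensor_smul,
    LinearMap.lTensor_id] at hz
  have regular_tensor : IsSMulRegular (M ⊗[R] R) x :=
    ((TensorProduct.rid R M).isSMulRegular_congr x).2 hreg
  have hw : w = 0 := regular_tensor.right_eq_zero_of_smul hz
  rw [hw, map_zero]

theorem lTensor_subtype_injective_of_isPrime_of_notMem {S M : Type*} [IsNoetherianRing R]
    [CommRing S] [IsNoetherianRing S] [Algebra R S] [AddCommGroup M] [Module R M] [Module S M]
    [IsScalarTower R S M] [Module.Finite S M] {P : Ideal R} [hP : P.IsPrime] {x : R}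
    [Module.Flat (R ⧸ Ideal.span {x}) ((R ⧸ Ideal.span {x}) ⊗[R] M)]
    (hx : algebraMap R S x ∈ Ideal.jacobson (⊥ : Ideal S)) (hreg : IsSMulRegular M x)
    (hxP : x ∉ P) : Function.Injective (P.subtype.lTensor M) := by
  let g : P →ₗ[R] P := x • LinearMap.id
  have exact_g : Function.Exact g (Algebra.linearMap R (R ⧸ Ideal.span {x}) ∘ₗ P.subtype) := by
    refine fun y ↦ (Ideal.Quotient.eq_zero_iff_mem.trans Ideal.mem_span_singleton').trans ⟨?_, ?_⟩
    · rintro ⟨c, hc⟩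
      have hcP : c ∈ P := (hP.mem_or_mem (hc ▸ y.2 : c * x ∈ P)).resolve_right hxP
      exact ⟨⟨c, hcP⟩, Subtype.ext ((mul_comm x c).trans hc)⟩
    · rintro ⟨c, rfl⟩
      exact ⟨c, mul_comm _ _⟩
  let K : Submodule S (M ⊗[R] P) :=
    LinearMap.ker (TensorProduct.AlgebraTensorModule.lTensor S M P.subtype)
  have K_le : K ≤ Ideal.span {algebraMap R S x} • K := fun z hz ↦ by
    replace hz : P.subtype.lTensor M z = 0 := hz
    obtain ⟨w, rfl⟩ := mem_range_lTensor_of_exact exact_g hz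
    rw [LinearMap.lTensor_smul, LinearMap.lTensor_id, LinearMap.smul_apply, map_smul] at hz
    have regular_tensor : IsSMulRegular (M ⊗[R] R) x :=
      ((TensorProduct.rid R M).isSMulRegular_congr x).2 hreg
    have hw : w ∈ K := regular_tensor.right_eq_zero_of_smul hz
    rw [LinearMap.lTensor_smul, LinearMap.lTensor_id, LinearMap.smul_apply,
      ← algebraMap_smul S x (LinearMap.id w)]
    exact Submodule.smul_mem_smul (Ideal.mem_span_singleton_self _) hw
  have : Module.Finite S (M ⊗[R] P) :=
    .equiv (TensorProduct.AlgebraTensorModule.cancelBaseChange R S S M P)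
  have K_eq_bot : K = ⊥ := Submodule.eq_bot_of_le_smul_of_le_jacobson_bot _ K
    (IsNoetherian.noetherian K) K_le ((Ideal.span_singleton_le_iff_mem _).2 hx)
  have hK : Function.Injective (TensorProduct.AlgebraTensorModule.lTensor S M P.subtype) :=
    LinearMap.ker_eq_bot.1 K_eq_bot
  exact hK

theorem flat_of_isSMulRegular_of_flat_quotient {S M : Type*} [IsNoetherianRing R] [CommRing S]
    [IsNoetherianRing S] [Algebra R S] [AddCommGroup M] [Module R M] [Module S M]
    [IsScalarTower R S M] [Module.Finite S M] {x : R}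
    [Module.Flat (R ⧸ Ideal.span {x}) ((R ⧸ Ideal.span {x}) ⊗[R] M)]
    (hx : algebraMap R S x ∈ Ideal.jacobson (⊥ : Ideal S)) (hreg : IsSMulRegular M x) :
    Module.Flat R M :=
  flat_of_forall_isPrime_rTensor_injective fun P _ ↦
    (LinearMap.lTensor_inj_iff_rTensor_inj M _).1 <|
      (em (x ∈ P)).elim (lTensor_subtype_injective_of_mem hreg)
        (lTensor_subtype_injective_of_isPrime_of_notMem hx hreg)

end LocalCriterion

open RingTheory.Sequence

theorem map_mk_ofList_cons {R : Type*} [CommRing R] (x : R) (rs : List R) :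
    (Ideal.ofList (x :: rs)).map (Ideal.Quotient.mk (Ideal.span {x})) =
      Ideal.ofList (rs.map (Ideal.Quotient.mk (Ideal.span {x}))) := by
  rw [Ideal.ofList_cons, Ideal.map_sup, Ideal.map_quotient_self, bot_sup_eq, Ideal.map_ofList]

theorem flat_of_isWeaklyRegular {R S : Type*} [CommRing R] [IsNoetherianRing R] [CommRing S]
    [IsNoetherianRing S] [Algebra R S] {rs : List R} (hmax : (Ideal.ofList rs).IsMaximal)
    (hjac : ∀ r ∈ rs, algebraMap R S r ∈ Ideal.jacobson (⊥ : Ideal S))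
    (hreg : IsWeaklyRegular S rs) : Module.Flat R S := by
  induction hn : rs.length generalizing R S rs with
  | zero =>
    obtain rfl := List.length_eq_zero_iff.1 hn
    rw [Ideal.ofList_nil] at hmax
    have : Nontrivial R := nontrivial_of_ne 0 1 fun h ↦
      hmax.ne_top ((Ideal.eq_top_iff_one _).2 (Ideal.mem_bot.2 h.symm))
    let : Field R := (Ring.isField_iff_maximal_bot.2 hmax).toField
    infer_instance
  | succ n ih =>
    obtain ⟨x, rs, rfl⟩ := List.exists_cons_of_length_eq_add_one hn
    obtain ⟨hx, hrs⟩ := (isWeaklyRegular_cons_iff _ _ _).1 hreg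
    let φ := Ideal.Quotient.mk (Ideal.span {x})
    let S' := S ⧸ (Ideal.span {x}).map (algebraMap R S)
    let π : S →+* S' := Ideal.Quotient.mk _
    let e : S' ≃ₐ[R ⧸ Ideal.span {x}] (R ⧸ Ideal.span {x}) ⊗[R] S :=
      Algebra.TensorProduct.quotIdealMapEquivQuotTensor S (Ideal.span {x})
    have quotient_max : (Ideal.ofList (rs.map φ)).IsMaximal := by
      have mem : x ∈ Ideal.ofList (x :: rs) := Ideal.subset_span List.mem_cons_self
      rw [← map_mk_ofList_cons]
      exact .map_of_surjective_of_ker_le Ideal.Quotient.mk_surjective <| by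
        rwa [Ideal.mk_ker, Ideal.span_singleton_le_iff_mem]
    have quotient_jac : ∀ r ∈ rs.map φ, algebraMap (R ⧸ Ideal.span {x}) S' r ∈
        Ideal.jacobson (⊥ : Ideal S') := by
      rw [List.forall_mem_map]
      have jac_le : Ideal.jacobson ⊥ ≤ (Ideal.jacobson ⊥).comap π := by
        rw [Ideal.comap_jacobson_of_surjective Ideal.Quotient.mk_surjective]
        exact Ideal.jacobson_mono bot_le
      exact fun r hr ↦ jac_le (hjac r (List.mem_cons_of_mem x hr))
    have quotient_reg : IsWeaklyRegular S' (rs.map φ) := by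
      refine (isWeaklyRegular_map_algebraMap_iff _ _ rs).2 ?_
      refine (LinearEquiv.isWeaklyRegular_congr ?_ rs).1 hrs
      exact QuotSMulTop.equivQuotTensor x S ≪≫ₗ (e.toLinearEquiv.restrictScalars R).symm
    have : Module.Flat (R ⧸ Ideal.span {x}) S' :=
      ih quotient_max quotient_jac quotient_reg (by simpa using hn)
    have : Module.Flat (R ⧸ Ideal.span {x}) ((R ⧸ Ideal.span {x}) ⊗[R] S) :=
      .of_linearEquiv e.symm.toLinearEquiv
    exact flat_of_isSMulRegular_of_flat_quotient (hjac x List.mem_cons_self) hx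

theorem isWeaklyRegular_map_pow {R M : Type*} [CommRing R] [AddCommGroup M] [Module R M]
    [IsNoetherian R M] {rs : List R} (hjac : ∀ r ∈ rs, r ∈ Ideal.jacobson (⊥ : Ideal R))
    (hreg : IsWeaklyRegular M rs) {n : ℕ} (hn : n ≠ 0) :
    IsWeaklyRegular M (rs.map (· ^ n)) := by
  induction rs generalizing M with
  | nil => exact hreg
  | cons x rs ih =>
    obtain ⟨hx, hrs⟩ := (isWeaklyRegular_cons_iff M x rs).1 hreg
    rw [List.forall_mem_cons] at hjac
    have perm {as bs : List R} (h : IsWeaklyRegular M as) (hab : as.Perm bs)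
        (has : ∀ a ∈ as, a ∈ Ideal.jacobson (⊥ : Ideal R)) : IsWeaklyRegular M bs :=
      h.of_perm_of_subset_jacobson_annihilator hab fun a ha ↦ Ideal.jacobson_mono bot_le (has a ha)
    have pow_jac {r : R} (hr : r ∈ Ideal.jacobson (⊥ : Ideal R)) :
        r ^ n ∈ Ideal.jacobson (⊥ : Ideal R) := Ideal.pow_mem_of_mem _ hr n hn.bot_lt
    have tail_jac : ∀ r ∈ rs.map (· ^ n), r ∈ Ideal.jacobson (⊥ : Ideal R) :=
      List.forall_mem_map.2 fun r hr ↦ pow_jac (hjac.2 r hr)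
    have append_reg : IsWeaklyRegular M (rs.map (· ^ n) ++ [x]) :=
      perm (.cons hx (ih hjac.2 hrs)) (List.perm_append_singleton x _).symm
        (List.forall_mem_cons.2 ⟨hjac.1, tail_jac⟩)
    rw [isWeaklyRegular_append_iff, isWeaklyRegular_singleton_iff] at append_reg
    refine perm (as := rs.map (· ^ n) ++ [x ^ n]) ?_ (List.perm_append_singleton _ _) ?_
    · rw [isWeaklyRegular_append_iff, isWeaklyRegular_singleton_iff]
      exact ⟨append_reg.1, append_reg.2.pow n⟩
    · exact List.forall_mem_append.2 ⟨tail_jac, List.forall_mem_singleton.2 (pow_jac hjac.1)⟩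

theorem flat_of_isWeaklyRegular_map {R S : Type*} [CommRing R] [IsNoetherianRing R] [CommRing S]
    [IsNoetherianRing S] {φ : R →+* S} {rs : List R} (hmax : (Ideal.ofList rs).IsMaximal)
    (hjac : ∀ r ∈ rs, φ r ∈ Ideal.jacobson (⊥ : Ideal S))
    (hreg : IsWeaklyRegular S (rs.map φ)) : φ.Flat := by
  algebraize [φ]
  exact flat_of_isWeaklyRegular hmax hjac ((isWeaklyRegular_map_algebraMap_iff S S rs).1 hreg)

/-! ### Regular local rings -/

section RegularLocalRing

open IsLocalRing

theorem isDomain_of_isDomain_quotient_span_singleton {R : Type*} [CommRing R] [IsNoetherianRing R]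
    {x : R} [IsDomain (R ⧸ Ideal.span {x})] (hjac : x ∈ Ideal.jacobson (⊥ : Ideal R))
    (hx : ∀ P ∈ minimalPrimes R, x ∉ P) : IsDomain R := by
  have : (Ideal.span {x}).IsPrime := (Ideal.Quotient.isDomain_iff_prime _).1 inferInstance
  obtain ⟨P, hP, P_le⟩ := Ideal.exists_minimalPrimes_le (I := ⊥) (J := Ideal.span {x}) bot_le
  have P_prime : P.IsPrime := Ideal.IsMinimalPrime.isPrime hP
  have P_le_smul : P ≤ Ideal.span {x} • P := fun y hy ↦ by
    obtain ⟨z, rfl⟩ := Ideal.mem_span_singleton'.1 (P_le hy)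
    rw [mul_comm]
    exact Submodule.smul_mem_smul (Ideal.mem_span_singleton_self x)
      ((P_prime.mem_or_mem hy).resolve_right (hx P hP))
  have P_eq_bot : P = ⊥ := Submodule.eq_bot_of_le_smul_of_le_jacobson_bot _ P
    (IsNoetherian.noetherian P) P_le_smul ((Ideal.span_singleton_le_iff_mem _).2 hjac)
  rw [P_eq_bot] at P_prime
  exact IsDomain.of_bot_isPrime R

variable {R : Type*} [CommRing R] [IsLocalRing R] [IsNoetherianRing R]

theorem exists_mem_maximalIdeal_notMem_sq_notMem_minimalPrimes
    (h : maximalIdeal R ∉ minimalPrimes R) :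
    ∃ x ∈ maximalIdeal R, x ∉ maximalIdeal R ^ 2 ∧ ∀ P ∈ minimalPrimes R, x ∉ P := by
  by_contra! hcover
  have subset_union : (maximalIdeal R : Set R) ⊆
      ⋃ I ∈ insert (maximalIdeal R ^ 2) (minimalPrimes R), I := fun x hx ↦ by
    by_cases hx2 : x ∈ maximalIdeal R ^ 2
    · exact Set.mem_biUnion (Set.mem_insert _ _) hx2
    · obtain ⟨P, hP, hxP⟩ := hcover x hx hx2
      exact Set.mem_biUnion (Set.mem_insert_of_mem _ hP) hxP
  obtain ⟨I, rfl | hI, le⟩ := (Ideal.subset_union_prime_finite (f := id)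
    ((minimalPrimes.finite_of_isNoetherianRing R).insert _) (maximalIdeal R ^ 2)
    (maximalIdeal R ^ 2) fun P hP hne _ ↦
      Ideal.IsMinimalPrime.isPrime (hP.resolve_left hne)).1 subset_union
  · have eq_bot : maximalIdeal R = ⊥ :=
      Submodule.eq_bot_of_le_smul_of_le_jacobson_bot (maximalIdeal R) _
        (IsNoetherian.noetherian _) (by simpa [sq] using le) (maximalIdeal_le_jacobson _)
    exact h ⟨⟨inferInstance, bot_le⟩, fun _ _ _ ↦ eq_bot ▸ bot_le⟩
  · have hIp := Ideal.IsMinimalPrime.isPrime hI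
    exact h (le_antisymm le (le_maximalIdeal hIp.ne_top) ▸ hI)

theorem exists_map_mem_span_image_erase {R S : Type*} [CommRing R] [IsLocalRing R]
    [DecidableEq R] [CommRing S] {f : R →+* S} {s : Finset R}
    (hs : ∀ a ∈ s, a ∈ maximalIdeal R) {x : R} (hx : x ∈ Ideal.span (s : Set R))
    (hx2 : x ∉ maximalIdeal R ^ 2) (hfx : f x = 0) :
    ∃ a ∈ s, f a ∈ Ideal.span (f '' (s.erase a)) := by
  obtain ⟨c, -, rfl⟩ := Submodule.mem_span_finset.1 hx
  obtain ⟨a, ha, c_unit⟩ : ∃ a ∈ s, IsUnit (c a) := by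
    by_contra! c_nonunit
    refine hx2 (sq (maximalIdeal R) ▸ Ideal.sum_mem _ fun a ha ↦ ?_)
    exact Ideal.mul_mem_mul ((mem_maximalIdeal _).2 (c_nonunit a ha)) (hs a ha)
  refine ⟨a, ha, ?_⟩
  rw [← Finset.add_sum_erase _ _ ha, map_add, map_sum, smul_eq_mul, map_mul] at hfx
  rw [← Ideal.unit_mul_mem_iff_mem _ (c_unit.map f), eq_neg_of_add_eq_zero_left hfx]
  refine neg_mem (Ideal.sum_mem _ fun b hb ↦ ?_)
  rw [smul_eq_mul, map_mul]
  exact Ideal.mul_mem_left _ _ (Ideal.subset_span (Set.mem_image_of_mem f hb))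

theorem spanFinrank_maximalIdeal_lt_of_surjective {S : Type*} [CommRing S] [IsLocalRing S]
    {f : R →+* S} (hf : Function.Surjective f) {x : R} (hx : x ∈ maximalIdeal R)
    (hx2 : x ∉ maximalIdeal R ^ 2) (hfx : f x = 0) :
    (maximalIdeal S).spanFinrank < (maximalIdeal R).spanFinrank := by
  classical
  obtain ⟨s, s_card, s_span⟩ := Submodule.FG.exists_span_finset_card_eq_spanFinrank
    (maximalIdeal R).fg_of_isNoetherianRing
  replace s_span : Ideal.span (s : Set R) = maximalIdeal R := s_span
  obtain ⟨a, ha, a_mem⟩ := exists_map_mem_span_image_erase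
    (fun a ha ↦ s_span ▸ Ideal.subset_span ha) (s_span ▸ hx) hx2 hfx
  have maximalIdeal_eq : maximalIdeal S = Ideal.span (f '' (s.erase a)) :=
    calc maximalIdeal S = (maximalIdeal R).map f := (map_maximalIdeal_of_surjective f hf).symm
      _ = Ideal.span (f '' s) := by rw [← s_span, Ideal.map_span]
      _ = Ideal.span (insert (f a) (f '' (s.erase a))) := by
        rw [← Set.image_insert_eq, ← Finset.coe_insert, Finset.insert_erase ha]
      _ = Ideal.span (f '' (s.erase a)) := Submodule.span_insert_eq_span a_mem
  calc (maximalIdeal S).spanFinrank ≤ (f '' (s.erase a)).ncard :=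
        maximalIdeal_eq ▸ Submodule.spanFinrank_span_le_ncard_of_finite (Set.toFinite _)
    _ ≤ (s.erase a).card := (Set.ncard_image_le (Set.toFinite _)).trans (Set.ncard_coe_finset _).le
    _ < (maximalIdeal R).spanFinrank := s_card ▸ Finset.card_erase_lt_of_mem ha

theorem isRegularLocalRing_quotient_span_singleton {R : Type*} [CommRing R] [IsRegularLocalRing R]
    {x : R} (hx : x ∈ maximalIdeal R) (hx2 : x ∉ maximalIdeal R ^ 2) :
    IsRegularLocalRing (R ⧸ Ideal.span {x}) := by
  have : Nontrivial (R ⧸ Ideal.span {x}) := Ideal.Quotient.nontrivial_iff.2 fun h ↦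
    (maximalIdeal.isMaximal R).ne_top
      (top_unique (h ▸ (Ideal.span_singleton_le_iff_mem _).2 hx))
  have : IsLocalRing (R ⧸ Ideal.span {x}) :=
    .of_surjective' (Ideal.Quotient.mk _) Ideal.Quotient.mk_surjective
  have spanFinrank_lt := spanFinrank_maximalIdeal_lt_of_surjective Ideal.Quotient.mk_surjective
    hx hx2 (Ideal.Quotient.eq_zero_iff_mem.2 (Ideal.mem_span_singleton_self x))
  have dim_le := ringKrullDim_le_ringKrullDim_quotient_add_card (R := R) {x}
    (by simpa [ringJacobson_eq_maximalIdeal] using hx)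
  rw [Finset.coe_singleton, Finset.card_singleton, ← IsRegularLocalRing.spanFinrank_maximalIdeal,
    Nat.cast_one] at dim_le
  refine .of_spanFinrank_maximalIdeal_le _ (ENat.WithBot.add_le_add_one_right_iff.1 ?_)
  exact le_trans (mod_cast spanFinrank_lt) dim_le

theorem maximalIdeal_eq_bot_of_mem_minimalPrimes {R : Type*} [CommRing R] [IsRegularLocalRing R]
    (h : maximalIdeal R ∈ minimalPrimes R) : maximalIdeal R = ⊥ := by
  rw [← Submodule.spanFinrank_eq_zero_iff_eq_bot (maximalIdeal R).fg_of_isNoetherianRing]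
  have dim_eq_zero : ringKrullDim R = 0 := by
    rw [← maximalIdeal_height_eq_ringKrullDim, Ideal.height_eq_zero_iff.2 h]
    rfl
  rwa [← IsRegularLocalRing.spanFinrank_maximalIdeal, Nat.cast_eq_zero] at dim_eq_zero

theorem isDomain_and_exists_isWeaklyRegular_ofList_eq_maximalIdeal (R : Type*) [CommRing R]
    [IsRegularLocalRing R] :
    IsDomain R ∧ ∃ rs : List R, Ideal.ofList rs = maximalIdeal R ∧ IsWeaklyRegular R rs := by
  induction hd : (maximalIdeal R).spanFinrank using Nat.strong_induction_on generalizing R with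
  | _ d ih =>
    subst hd
    by_cases hmin : maximalIdeal R ∈ minimalPrimes R
    · have eq_bot := maximalIdeal_eq_bot_of_mem_minimalPrimes hmin
      exact ⟨(isField_iff_maximalIdeal_eq.2 eq_bot).isDomain, [],
        by rw [Ideal.ofList_nil, eq_bot], .nil R R⟩
    obtain ⟨x, hx, hx2, hxP⟩ := exists_mem_maximalIdeal_notMem_sq_notMem_minimalPrimes hmin
    have := isRegularLocalRing_quotient_span_singleton hx hx2
    obtain ⟨quotient_domain, rs, rs_span, rs_reg⟩ := ih _
      (spanFinrank_maximalIdeal_lt_of_surjective Ideal.Quotient.mk_surjective hx hx2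
        (Ideal.Quotient.eq_zero_iff_mem.2 (Ideal.mem_span_singleton_self x)))
      (R ⧸ Ideal.span {x}) rfl
    obtain ⟨rs, rfl⟩ := List.map_surjective_iff.2 Ideal.Quotient.mk_surjective rs
    have domain : IsDomain R :=
      isDomain_of_isDomain_quotient_span_singleton (maximalIdeal_le_jacobson _ hx) hxP
    have x_ne_zero : x ≠ 0 := fun h ↦ hx2 (h ▸ zero_mem _)
    refine ⟨domain, x :: rs, ?_, .cons (.of_ne_zero x_ne_zero) ?_⟩
    · have le_maximalIdeal : Ideal.span {x} ≤ maximalIdeal R :=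
        (Ideal.span_singleton_le_iff_mem _).2 hx
      have le_ofList : Ideal.span {x} ≤ Ideal.ofList (x :: rs) := by
        rw [Ideal.ofList_cons]
        exact le_sup_left
      rw [← Ideal.comap_map_mk le_ofList, map_mk_ofList_cons, rs_span,
        ← map_maximalIdeal_of_surjective _ Ideal.Quotient.mk_surjective,
        Ideal.comap_map_mk le_maximalIdeal]
    · let e : QuotSMulTop x R ≃ₗ[R] R ⧸ Ideal.span {x} :=
        QuotSMulTop.equivQuotTensor x R ≪≫ₗ TensorProduct.rid R _
      rw [e.isWeaklyRegular_congr, ← isWeaklyRegular_map_algebraMap_iff (R ⧸ Ideal.span {x})]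
      exact rs_reg

theorem isDomain_of_isRegularLocalRing (R : Type*) [CommRing R] [IsRegularLocalRing R] :
    IsDomain R :=
  (isDomain_and_exists_isWeaklyRegular_ofList_eq_maximalIdeal R).1

theorem flat_frobenius (R : Type*) [CommRing R] [IsRegularLocalRing R]
    (p : ℕ) [Fact p.Prime] [CharP R p] : (frobenius R p).Flat := by
  have hp : p ≠ 0 := (Fact.out : p.Prime).ne_zero
  obtain ⟨-, rs, rs_span, rs_reg⟩ := isDomain_and_exists_isWeaklyRegular_ofList_eq_maximalIdeal R
  have rs_jac : ∀ r ∈ rs, r ∈ Ideal.jacobson (⊥ : Ideal R) := fun r hr ↦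
    maximalIdeal_le_jacobson _ (rs_span ▸ Ideal.subset_span hr)
  exact flat_of_isWeaklyRegular_map (rs_span ▸ maximalIdeal.isMaximal R)
    (fun r hr ↦ Ideal.pow_mem_of_mem _ (rs_jac r hr) p hp.bot_lt)
    (isWeaklyRegular_map_pow rs_jac rs_reg hp)

end RegularLocalRing

/-! ### Relations between `p`-th powers -/

theorem vanishesTrivially_of_forall_sum_smul_eq_zero {R M ι κ : Type*} [CommRing R]
    [AddCommGroup M] [Module R M] [Module.Flat R M] [Fintype ι] [Finite κ]
    {b : ι → κ → R} {w : ι → M} (h : ∀ j, ∑ i, b i j • w i = 0) :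
    TensorProduct.VanishesTrivially R b w := by
  classical
  cases nonempty_fintype κ
  refine TensorProduct.vanishesTrivially_of_sum_tmul_eq_zero_of_rTensor_injective R
    (Module.Flat.rTensor_preserves_injective_linearMap _ (Submodule.injective_subtype _)) ?_
  apply (TensorProduct.comm R (κ → R) M ≪≫ₗ TensorProduct.piScalarRight R R M κ).injective
  ext j
  simpa using h j

theorem exists_of_flat_of_forall_sum_mul_map_eq_zero {R S ι κ : Type*} [CommRing R] [CommRing S]
    {φ : R →+* S} (hφ : φ.Flat) [Fintype ι] [Finite κ] {b : ι → κ → R} {w : ι → S}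
    (h : ∀ j, ∑ i, w i * φ (b i j) = 0) :
    ∃ (k : ℕ) (v : Fin k → ι → R) (y : Fin k → S),
      (∀ l j, ∑ i, v l i * b i j = 0) ∧ ∀ i, w i = ∑ l, y l * φ (v l i) := by
  algebraize [φ]
  obtain ⟨k, v, y, hw, hv⟩ := vanishesTrivially_of_forall_sum_smul_eq_zero (R := R) (b := b)
    (w := w) fun j ↦ by
      simpa only [Algebra.smul_def, RingHom.algebraMap_toAlgebra, mul_comm] using h j
  refine ⟨k, fun l i ↦ v i l, y, fun l j ↦ ?_, fun i ↦ ?_⟩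
  · simpa only [Finset.sum_apply, Pi.smul_apply, smul_eq_mul, Pi.zero_apply] using congrFun (hv l) j
  · simpa only [Algebra.smul_def, RingHom.algebraMap_toAlgebra, mul_comm] using hw i

theorem exists_linearIndependent_smul_eq_sum (R K : Type*) {V ι : Type*} [CommRing R] [Field K]
    [Algebra R K] [IsFractionRing R K] [AddCommGroup V] [Module K V] [Module R V]
    [IsScalarTower R K V] [Finite ι] (s : ι → V) :
    ∃ (n : ℕ) (e : Fin n → V) (b : nonZeroDivisors R) (B : ι → Fin n → R),
      LinearIndependent K e ∧ ∀ i, (b : R) • s i = ∑ j, B i j • e j := by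
  have := FiniteDimensional.span_of_finite K (Set.finite_range s)
  let e := Module.finBasis K (Submodule.span K (Set.range s))
  let σ (i : ι) : Submodule.span K (Set.range s) := ⟨s i, Submodule.subset_span ⟨i, rfl⟩⟩
  obtain ⟨b, hb⟩ := IsLocalization.exist_integer_multiples_of_finite (nonZeroDivisors R)
    fun ij : ι × Fin _ ↦ e.repr (σ ij.1) ij.2
  choose B hB using hb
  refine ⟨_, fun j ↦ e j, b, fun i j ↦ B (i, j),
    e.linearIndependent.map' _ (Submodule.ker_subtype _), fun i ↦ ?_⟩
  have hs : ∑ j, e.repr (σ i) j • (e j : V) = s i := by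
    simpa only [AddSubmonoidClass.coe_finsetSum, Submodule.coe_smul] using
      congrArg Subtype.val (e.sum_repr (σ i))
  rw [← hs, Finset.smul_sum]
  refine Finset.sum_congr rfl fun j _ ↦ ?_
  rw [← smul_assoc, ← hB (i, j), algebraMap_smul]

/-- Injectivity of the relative Frobenius `F_* R ⊗[R] A → A`, `w ⊗ a ↦ w • a ^ p`, in elementwise
form: by the equational criterion for vanishing in a tensor product, every relation between
`p`-th powers is a combination of `p`-th powers of relations. -/
def RelativeFrobeniusInjective (p : ℕ) (R A : Type*) [CommRing R] [CommRing A] [Algebra R A] :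
    Prop :=
  ∀ ⦃n : ℕ⦄ (w : Fin n → R) (s : Fin n → A), ∑ i, w i • s i ^ p = 0 →
    ∃ (k : ℕ) (v : Fin k → Fin n → R) (y : Fin k → R),
      (∀ l, ∑ i, v l i • s i = 0) ∧ ∀ i, w i = ∑ l, y l * v l i ^ p

theorem relativeFrobeniusInjective_of_isSeparable {R : Type*} [CommRing R] [IsDomain R] (p : ℕ)
    [Fact p.Prime] [CharP R p] (hR : (frobenius R p).Flat)
    (K L : Type*) [Field K] [Algebra R K] [IsFractionRing R K] [Field L] [Algebra R L]
    [Algebra K L] [IsScalarTower R K L] [Algebra.IsSeparable K L] :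
    RelativeFrobeniusInjective p R L := by
  have hK : CharP K p := charP_of_injective_ringHom (IsFractionRing.injective R K) p
  have hL : CharP L p := charP_of_injective_ringHom (algebraMap K L).injective p
  have : ExpChar K p := .prime Fact.out
  have : FaithfulSMul R L := by
    rw [faithfulSMul_iff_algebraMap_injective, IsScalarTower.algebraMap_eq R K L]
    exact (algebraMap K L).injective.comp (IsFractionRing.injective R K)
  intro n w s h
  obtain ⟨N, e, b, B, he, hs⟩ := exists_linearIndependent_smul_eq_sum R K s
  have hep : LinearIndependent R fun j ↦ e j ^ p := by
    have := he.map_pow_expChar_pow_of_isSeparable p 1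
    simp only [pow_one] at this
    exact this.restrict_scalars (by
      simpa [Algebra.smul_def] using IsFractionRing.injective R K)
  have hB (j) : ∑ i, w i * frobenius R p (B i j) = 0 := by
    refine Fintype.linearIndependent_iff.1 hep (fun j ↦ ∑ i, w i * B i j ^ p) ?_ j
    calc ∑ j, (∑ i, w i * B i j ^ p) • e j ^ p
        = ∑ i, w i • (∑ j, B i j • e j) ^ p := by
          simp only [sum_pow_char, smul_pow, Finset.smul_sum, Finset.sum_smul, mul_smul]
          exact Finset.sum_comm
      _ = (b : R) ^ p • ∑ i, w i • s i ^ p := by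
          simp only [← hs, smul_pow, Finset.smul_sum, smul_comm (w _)]
      _ = 0 := by rw [h, smul_zero]
  obtain ⟨k, v, y, hv, hw⟩ := exists_of_flat_of_forall_sum_mul_map_eq_zero hR hB
  refine ⟨k, v, y, fun l ↦ ?_, hw⟩
  refine (smul_eq_zero_iff_right (nonZeroDivisors.ne_zero b.2)).1 ?_
  calc (b : R) • ∑ i, v l i • s i = ∑ i, v l i • ∑ j, B i j • e j := by
        simp only [← hs, Finset.smul_sum, smul_comm (v l _)]
    _ = ∑ j, (∑ i, v l i * B i j) • e j := by
        simp only [Finset.smul_sum, Finset.sum_smul, mul_smul]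
        exact Finset.sum_comm
    _ = 0 := by simp only [hv, zero_smul, Finset.sum_const_zero]

theorem sum_vecMul_smul {R M m n : Type*} [Semiring R] [AddCommMonoid M] [Module R M] [Fintype m]
    [Fintype n] (v : m → R) (C : Matrix m n R) (t : n → M) :
    ∑ j, Matrix.vecMul v C j • t j = ∑ i, v i • ∑ j, C i j • t j := by
  simp only [Matrix.vecMul, dotProduct, Finset.sum_smul, Finset.smul_sum, mul_smul]
  exact Finset.sum_comm

namespace RelativeFrobeniusInjective

variable {p : ℕ} {R A : Type*} [CommRing R] [CommRing A] [Algebra R A]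

theorem subalgebra (hA : RelativeFrobeniusInjective p R A) (B : Subalgebra R A) :
    RelativeFrobeniusInjective p R B := by
  intro n w s h
  obtain ⟨k, v, y, hv, hw⟩ := hA w (fun i ↦ s i) (by simpa using congrArg B.val h)
  exact ⟨k, v, y, fun l ↦ Subtype.ext (by simpa using hv l), hw⟩

variable [Fact p.Prime]

theorem mem_span_of_pow_mem_span (hA : RelativeFrobeniusInjective p R A) {n : ℕ} {s : Fin n → A}
    {x : A} (h : x ^ p ∈ Submodule.span R (Set.range fun i ↦ s i ^ p)) :
    x ∈ Submodule.span R (Set.range s) := by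
  obtain ⟨r, hr⟩ := (Submodule.mem_span_range_iff_exists_fun R).1 h
  obtain ⟨k, v, y, hv, hw⟩ := hA (Fin.cons (-1) r) (Fin.cons x s) (by simp [Fin.sum_univ_succ, hr])
  let I : Ideal R := (Submodule.span R (Set.range s)).comap (LinearMap.toSpanSingleton R A x)
  have hvI (l) : v l 0 ∈ I := by
    have hx : v l 0 • x = -∑ i : Fin n, v l i.succ • s i :=
      eq_neg_of_add_eq_zero_left (by simpa [Fin.sum_univ_succ] using hv l)
    change v l 0 • x ∈ Submodule.span R (Set.range s)
    rw [hx, neg_mem_iff]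
    exact (Submodule.mem_span_range_iff_exists_fun R).2 ⟨_, rfl⟩
  have hI : -1 ∈ I := by
    have : -1 = ∑ l, y l * v l 0 ^ p := by simpa using hw 0
    rw [this]
    exact I.sum_mem fun l _ ↦ I.mul_mem_left _
      (I.pow_mem_of_mem (hvI l) _ (Fact.out : p.Prime).pos)
  simpa [I] using hI

theorem mem_span_of_pow_pow_mem_span (hA : RelativeFrobeniusInjective p R A) (m : ℕ) {n : ℕ}
    {s : Fin n → A} {x : A}
    (h : x ^ p ^ m ∈ Submodule.span R (Set.range fun i ↦ s i ^ p ^ m)) :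
    x ∈ Submodule.span R (Set.range s) := by
  induction m with
  | zero => simpa using h
  | succ m ih =>
    refine ih (hA.mem_span_of_pow_mem_span ?_)
    simpa only [← pow_mul, ← pow_succ] using h

theorem linearIndependent_pow_pow (hA : RelativeFrobeniusInjective p R A) (m : ℕ) {n : ℕ}
    {s : Fin n → A} (hs : LinearIndependent R s) : LinearIndependent R fun i ↦ s i ^ p ^ m := by
  induction m with
  | zero => simpa using hs
  | succ m ih =>
    refine Fintype.linearIndependent_iff.2 fun w hw i ↦ ?_
    obtain ⟨k, v, y, hv, hwv⟩ := hA w (fun i ↦ s i ^ p ^ m) (by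
      simpa only [← pow_mul, ← pow_succ] using hw)
    have hv0 (l) : v l i = 0 := Fintype.linearIndependent_iff.1 ih (v l) (hv l) i
    simp [hwv, hv0, (Fact.out : p.Prime).ne_zero]

open IsLocalRing

theorem mem_maximalIdeal_smul_of_sum_smul_pow_eq_zero
    (hA : RelativeFrobeniusInjective p R A) [IsLocalRing R] {n : ℕ} {s : Fin n → A} {J : Ideal R}
    (hm : ∀ v : Fin n → R, ∑ i, v i • s i = 0 → ∀ i, v i ∈ maximalIdeal R)
    (hJ : ∀ v : Fin n → R, ∑ i, v i • s i = 0 → ∀ i, v i ∈ J)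
    {w : Fin n → R} (hw : ∑ i, w i • s i ^ p = 0) (i : Fin n) : w i ∈ maximalIdeal R • J := by
  obtain ⟨k, v, y, hv, hwv⟩ := hA w s hw
  rw [hwv]
  refine Ideal.sum_mem _ fun l _ ↦ Ideal.mul_mem_left _ _ ?_
  rw [← Nat.sub_add_cancel (Fact.out : p.Prime).one_le, pow_succ]
  exact Submodule.smul_mem_smul (Ideal.pow_mem_of_mem _ (hm _ (hv l) i) _
    (Nat.sub_pos_of_lt (Fact.out : p.Prime).one_lt)) (hJ _ (hv l) i)

theorem linearIndependent_of_mem_span (hA : RelativeFrobeniusInjective p R A) [IsLocalRing R]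
    [IsNoetherianRing R] {n : ℕ} {s : Fin n → A}
    (hmin : ∀ v : Fin n → R, ∑ i, v i • s i = 0 → ∀ i, v i ∈ maximalIdeal R)
    (hC : ∀ i, s i ∈ Submodule.span R (Set.range fun i ↦ s i ^ p))
    (hD : ∀ i, s i ^ p ∈ Submodule.span R (Set.range s)) : LinearIndependent R s := by
  obtain ⟨C, hC⟩ : ∃ C : Matrix (Fin n) (Fin n) R, ∀ i, ∑ j, C i j • s j ^ p = s i :=
    Classical.skolem.1 fun i ↦ (Submodule.mem_span_range_iff_exists_fun R).1 (hC i)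
  obtain ⟨D, hD⟩ : ∃ D : Matrix (Fin n) (Fin n) R, ∀ i, ∑ j, D i j • s j = s i ^ p :=
    Classical.skolem.1 fun i ↦ (Submodule.mem_span_range_iff_exists_fun R).1 (hD i)
  let J : Ideal R := Ideal.span {r | ∃ v : Fin n → R, ∑ i, v i • s i = 0 ∧ ∃ i, v i = r}
  have mem_J (v : Fin n → R) (hv : ∑ i, v i • s i = 0) (i) : v i ∈ J :=
    Ideal.subset_span ⟨v, hv, i, rfl⟩
  have hCD (i) : ∑ k, (1 - C * D) i k • s k = 0 := by
    have hone : ∑ k, (1 : Matrix (Fin n) (Fin n) R) i k • s k = s i := by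
      simp only [Matrix.one_apply, ite_smul, one_smul, zero_smul, Finset.sum_ite_eq,
        Finset.mem_univ, if_true]
    simp only [Matrix.sub_apply, sub_smul, Finset.sum_sub_distrib, hone,
      Matrix.mul_apply_eq_vecMul, sum_vecMul_smul, hD, hC, sub_self]
  have hvC {v : Fin n → R} (hv : ∑ i, v i • s i = 0) (j) :
      Matrix.vecMul v C j ∈ maximalIdeal R • J :=
    hA.mem_maximalIdeal_smul_of_sum_smul_pow_eq_zero hmin mem_J
      (by simp only [sum_vecMul_smul, hC, hv]) j
  have hJ : J = ⊥ := by
    refine Submodule.eq_bot_of_le_smul_of_le_jacobson_bot (maximalIdeal R) _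
      (IsNoetherian.noetherian _) (Ideal.span_le.2 ?_) (maximalIdeal_le_jacobson _)
    rintro _ ⟨v, hv, i, rfl⟩
    -- `v C` is a relation between the `s j ^ p`, and the rows of `1 - C D` are relations
    -- between the `s j`.
    have hv' : v = Matrix.vecMul (Matrix.vecMul v C) D + Matrix.vecMul v (1 - C * D) := by
      rw [Matrix.vecMul_sub, Matrix.vecMul_one, Matrix.vecMul_vecMul, add_sub_cancel]
    rw [hv']
    change ∑ j, Matrix.vecMul v C j * D j i + ∑ j, v j * (1 - C * D) j i ∈ maximalIdeal R • J
    exact add_mem (Ideal.sum_mem _ fun j _ ↦ Ideal.mul_mem_right _ _ (hvC hv j))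
      (Ideal.sum_mem _ fun j _ ↦ Submodule.smul_mem_smul (hmin v hv j) (mem_J _ (hCD j) i))
  refine Fintype.linearIndependent_iff.2 fun v hv i ↦ ?_
  simpa only [hJ, Ideal.mem_bot] using mem_J v hv i

end RelativeFrobeniusInjective

theorem mem_span_range_comp_succAbove {R M : Type*} [CommRing R] [AddCommGroup M] [Module R M]
    {n : ℕ} {s : Fin (n + 1) → M} {v : Fin (n + 1) → R} (hv : ∑ j, v j • s j = 0)
    {i : Fin (n + 1)} (hi : IsUnit (v i)) :
    s i ∈ Submodule.span R (Set.range (s ∘ i.succAbove)) := by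
  rw [Fin.sum_univ_succAbove _ i] at hv
  rw [← Submodule.smul_mem_iff_of_isUnit _ hi, eq_neg_of_add_eq_zero_left hv, neg_mem_iff]
  exact (Submodule.mem_span_range_iff_exists_fun R).2 ⟨_, rfl⟩

theorem exists_span_range_eq_and_forall_mem_maximalIdeal {R M : Type*} [CommRing R]
    [IsLocalRing R] [AddCommGroup M] [Module R M] {N : Submodule R M} (hN : N.FG) :
    ∃ (n : ℕ) (s : Fin n → M), Submodule.span R (Set.range s) = N ∧
      ∀ v : Fin n → R, ∑ i, v i • s i = 0 → ∀ i, v i ∈ IsLocalRing.maximalIdeal R := by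
  classical
  have hex := Submodule.fg_iff_exists_fin_generating_family.1 hN
  obtain ⟨n, ⟨s, hs⟩, hmin⟩ : ∃ n, (∃ s : Fin n → M, Submodule.span R (Set.range s) = N) ∧
      ∀ m < n, ¬∃ s : Fin m → M, Submodule.span R (Set.range s) = N :=
    ⟨Nat.find hex, Nat.find_spec hex, fun _ ↦ Nat.find_min hex⟩
  refine ⟨n, s, hs, fun v hv i ↦ ?_⟩
  by_contra hvi
  obtain _ | n := n
  · exact i.elim0
  refine hmin n n.lt_succ_self ⟨s ∘ i.succAbove, ?_⟩
  have hsi := mem_span_range_comp_succAbove hv (IsLocalRing.notMem_maximalIdeal.1 hvi)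
  rw [← hs, ← Submodule.span_insert_eq_span hsi]
  rw [Set.range_comp, Fin.range_succAbove, ← Set.image_insert_eq, Set.insert_eq,
    Set.union_compl_self, Set.image_univ]

theorem formallyUnramified_of_span_range_pow_eq_top (p : ℕ) {R A : Type*} [CommRing R]
    [CommRing A] [Algebra R A] [CharP A p]
    (h : Submodule.span R (Set.range fun a : A ↦ a ^ p) = ⊤) :
    Algebra.FormallyUnramified R A := by
  have hD (a : A) : KaehlerDifferential.D R A a = 0 := by
    induction (h ▸ Submodule.mem_top : a ∈ Submodule.span R (Set.range fun a : A ↦ a ^ p))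
      using Submodule.span_induction with
    | mem x hx =>
      obtain ⟨b, rfl⟩ := hx
      rw [Derivation.leibniz_pow, ← Nat.cast_smul_eq_nsmul A, CharP.cast_eq_zero, zero_smul]
    | zero => exact map_zero _
    | add x y _ _ hx hy => rw [map_add, hx, hy, add_zero]
    | smul r x _ hx => rw [Derivation.map_smul, hx, smul_zero]
  rw [Algebra.formallyUnramified_iff, ← Submodule.subsingleton_iff A,
    ← subsingleton_iff_bot_eq_top, ← KaehlerDifferential.span_range_derivation, eq_comm,
    Submodule.span_eq_bot]
  rintro _ ⟨a, rfl⟩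
  exact hD a

theorem span_range_pow_eq_top {p : ℕ} [Fact p.Prime] {R A ι : Type*} [CommRing R] [CommRing A]
    [Algebra R A] [CharP A p] [Finite ι] {s : ι → A}
    (h : Submodule.span R (Set.range fun a : A ↦ a ^ p) = ⊤)
    (hs : Submodule.span R (Set.range s) = ⊤) :
    Submodule.span R (Set.range fun i ↦ s i ^ p) = ⊤ := by
  cases nonempty_fintype ι
  rw [eq_top_iff, ← h, Submodule.span_le]
  rintro _ ⟨a, rfl⟩
  obtain ⟨r, rfl⟩ := (Submodule.mem_span_range_iff_exists_fun R).1
    (hs ▸ Submodule.mem_top : a ∈ Submodule.span R (Set.range s))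
  simp only [sum_pow_char, smul_pow]
  exact (Submodule.mem_span_range_iff_exists_fun R).2 ⟨_, rfl⟩

namespace RelativeFrobeniusInjective

variable {p : ℕ} [Fact p.Prime] {R A : Type*} [CommRing R] [CommRing A] [Algebra R A]

theorem free (hA : RelativeFrobeniusInjective p R A) [IsLocalRing R] [IsNoetherianRing R]
    [CharP A p] [Module.Finite R A] (h : Submodule.span R (Set.range fun a : A ↦ a ^ p) = ⊤) :
    Module.Free R A := by
  obtain ⟨n, s, hs, hmin⟩ := exists_span_range_eq_and_forall_mem_maximalIdeal
    (Module.Finite.fg_top (R := R) (M := A))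
  have hsp := span_range_pow_eq_top h hs
  exact .of_basis (.mk (hA.linearIndependent_of_mem_span hmin (by simp [hsp]) (by simp [hs])) hs.ge)

theorem etale (hA : RelativeFrobeniusInjective p R A) [IsLocalRing R] [IsNoetherianRing R]
    [CharP A p] [Module.Finite R A] (h : Submodule.span R (Set.range fun a : A ↦ a ^ p) = ⊤) :
    Algebra.Etale R A := by
  have := hA.free h
  have := formallyUnramified_of_span_range_pow_eq_top p h
  have : Algebra.FinitePresentation R A := Algebra.FinitePresentation.of_finiteType.1 inferInstance
  exact .of_formallyUnramified_of_flat

end RelativeFrobeniusInjective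

theorem eq_zero_of_mem_span_range_pow {S ι : Type*} [CommRing S] [IsLocalRing S] [Finite ι]
    {v : ι → S} {q : ℕ} (hq : 1 < q) (hv : ∀ i, v i ∈ IsLocalRing.maximalIdeal S)
    (h : ∀ i, v i ∈ Ideal.span (Set.range fun j ↦ v j ^ q)) (i : ι) : v i = 0 := by
  have hspan : Ideal.span (Set.range v) = ⊥ := by
    refine Submodule.eq_bot_of_le_smul_of_le_jacobson_bot (IsLocalRing.maximalIdeal S) _
      (Submodule.fg_span (Set.finite_range _)) (Ideal.span_le.2 ?_)
      (IsLocalRing.maximalIdeal_le_jacobson _)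
    rintro _ ⟨i, rfl⟩
    refine Ideal.span_le.2 ?_ (h i)
    rintro _ ⟨j, rfl⟩
    change v j ^ q ∈ _
    rw [← Nat.sub_add_cancel hq.le, pow_succ]
    exact Submodule.smul_mem_smul (Ideal.pow_mem_of_mem _ (hv j) _ (Nat.sub_pos_of_lt hq))
      (Ideal.subset_span ⟨j, rfl⟩)
  exact Ideal.span_eq_bot.1 hspan _ ⟨i, rfl⟩

theorem eq_zero_of_pow_pow_eq_sum {p : ℕ} [Fact p.Prime] {R S ι : Type*} [CommRing R] [CommRing S]
    [IsLocalRing S] [IsReduced S] [CharP S p] [Algebra R S] [Fintype ι] {u : ι → S}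
    (hu : ∀ i, u i ∈ IsLocalRing.maximalIdeal S)
    (h : ∀ i, ∃ (m : ℕ) (r : ι → R), u i ^ p ^ m = ∑ j, r j • u j ^ p ^ (m + 1)) (i : ι) :
    u i = 0 := by
  choose m r hr using h
  let M := ∑ i, m i
  have hm (i) : m i ≤ M := Finset.single_le_sum (fun _ _ ↦ Nat.zero_le _) (Finset.mem_univ i)
  have hM (i) : u i ^ p ^ M = ∑ j, r i j ^ p ^ (M - m i) • (u j ^ p ^ M) ^ p := by
    calc u i ^ p ^ M = (∑ j, r i j • u j ^ p ^ (m i + 1)) ^ p ^ (M - m i) := by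
          rw [← hr, ← pow_mul, ← pow_add, Nat.add_sub_cancel' (hm i)]
      _ = ∑ j, r i j ^ p ^ (M - m i) • (u j ^ p ^ M) ^ p := by
          simp only [sum_pow_char_pow, smul_pow, ← pow_mul, ← pow_add, ← pow_succ]
          rw [show m i + 1 + (M - m i) = M + 1 by have := hm i; omega]
  refine eq_zero_of_pow_eq_zero (eq_zero_of_mem_span_range_pow (v := fun i ↦ u i ^ p ^ M)
    (Fact.out : p.Prime).one_lt
    (fun i ↦ Ideal.pow_mem_of_mem _ (hu i) _ (pow_pos (Fact.out : p.Prime).pos M)) (fun i ↦ ?_) i)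
  simp only [hM i, Algebra.smul_def]
  exact Ideal.sum_mem _ fun j _ ↦ Ideal.mul_mem_left _ _ (Ideal.subset_span ⟨j, rfl⟩)

/-- For a reduced `R`-algebra `S` of characteristic `p`, this says that the family `s` generates
`S_∞` as a module over `R_∞`: raising `x ^ (1 / p ^ n) = ∑ i, r i ^ (1 / p ^ (m + n)) • s i` to the
power `p ^ (m + n)` gives a relation in `S` that involves `R` and `S` only. -/
def SpansPerfectClosure (p : ℕ) (R : Type*) {S : Type*} [CommRing R] [CommRing S] [Algebra R S]
    {k : ℕ} (s : Fin k → S) : Prop :=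
  ∀ (x : S) (n : ℕ), ∃ (m : ℕ) (r : Fin k → R), x ^ p ^ m = ∑ i, r i • s i ^ p ^ (m + n)

namespace SpansPerfectClosure

variable {p : ℕ} [Fact p.Prime] {R S A : Type*} [CommRing R] [CommRing S] [CommRing A]
  [Algebra R S] [Algebra R A] {k : ℕ} {s : Fin k → S} {f : S →ₐ[R] A}

theorem span_range_pow_pow_eq_top (hs : SpansPerfectClosure p R s)
    (hA : RelativeFrobeniusInjective p R A) (hf : Function.Surjective f) (n : ℕ) :
    Submodule.span R (Set.range fun i ↦ f (s i) ^ p ^ n) = ⊤ := by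
  refine eq_top_iff.2 fun a _ ↦ ?_
  obtain ⟨x, rfl⟩ := hf a
  obtain ⟨m, r, hr⟩ := hs x n
  refine hA.mem_span_of_pow_pow_mem_span m ((Submodule.mem_span_range_iff_exists_fun R).2 ⟨r, ?_⟩)
  simpa only [map_pow, map_sum, map_smul, ← pow_mul, ← pow_add, add_comm n m] using
    (congrArg f hr).symm

theorem finite (hs : SpansPerfectClosure p R s) (hA : RelativeFrobeniusInjective p R A)
    (hf : Function.Surjective f) : Module.Finite R A := by
  refine ⟨Submodule.fg_iff_exists_fin_generating_family.2 ⟨k, fun i ↦ f (s i), ?_⟩⟩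
  simpa using hs.span_range_pow_pow_eq_top hA hf 0

theorem span_range_pow_eq_top (hs : SpansPerfectClosure p R s)
    (hA : RelativeFrobeniusInjective p R A) (hf : Function.Surjective f) :
    Submodule.span R (Set.range fun a : A ↦ a ^ p) = ⊤ := by
  rw [eq_top_iff, ← hs.span_range_pow_pow_eq_top hA hf 1]
  refine Submodule.span_mono ?_
  rintro _ ⟨i, rfl⟩
  exact ⟨f (s i), by simp⟩

/-- Subtracting from each `s i` a lift of its image in terms of a basis of `A` gives generators of
the kernel. -/
theorem exists_forall_mem_ker (hs : SpansPerfectClosure p R s)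
    (hA : RelativeFrobeniusInjective p R A) (hf : Function.Surjective f) [CharP S p]
    [Module.Finite R A] [Module.Free R A] [Nontrivial R] :
    ∃ u : Fin k → S, (∀ i, f (u i) = 0) ∧ ∀ x, f x = 0 → ∀ n, ∃ (m : ℕ) (r : Fin k → R),
      x ^ p ^ m = ∑ i, r i • u i ^ p ^ (m + n) := by
  let t := Module.finBasis R A
  choose α hα using fun a ↦ hf (t a)
  let c (i : Fin k) := t.repr (f (s i))
  let u (i : Fin k) : S := s i - ∑ a, c i a • α a
  have hu (i) : f (u i) = 0 := by
    simp only [u, c, map_sub, map_sum, map_smul, hα, t.sum_repr, sub_self]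
  have hp (q : ℕ) : p ^ q ≠ 0 := pow_ne_zero _ (Fact.out : p.Prime).ne_zero
  refine ⟨u, hu, fun x hx n ↦ ?_⟩
  obtain ⟨m, r, hr⟩ := hs x n
  have hsu (i) : s i ^ p ^ (m + n) =
      u i ^ p ^ (m + n) + ∑ a, c i a ^ p ^ (m + n) • α a ^ p ^ (m + n) := by
    simp only [← smul_pow]
    rw [← sum_pow_char_pow, ← add_pow_char_pow, sub_add_cancel]
  have hsum : x ^ p ^ m = ∑ i, r i • u i ^ p ^ (m + n) +
      ∑ a, (∑ i, r i * c i a ^ p ^ (m + n)) • α a ^ p ^ (m + n) := by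
    simp only [hr, hsu, smul_add, Finset.sum_add_distrib, Finset.smul_sum, Finset.sum_smul,
      mul_smul]
    rw [Finset.sum_comm (γ := Fin _)]
  have hzero (a) : ∑ i, r i * c i a ^ p ^ (m + n) = 0 := by
    refine Fintype.linearIndependent_iff.1
      (hA.linearIndependent_pow_pow (m + n) t.linearIndependent)
      (fun a ↦ ∑ i, r i * c i a ^ p ^ (m + n)) ?_ a
    simpa only [map_pow, map_add, map_sum, map_smul, hx, hu, hα, zero_pow (hp _), smul_zero,
      Finset.sum_const_zero, zero_add] using (congrArg f hsum).symm
  exact ⟨m, r, by simpa [hzero] using hsum⟩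

theorem injective (hs : SpansPerfectClosure p R s) (hA : RelativeFrobeniusInjective p R A)
    (hf : Function.Surjective f) [Nontrivial A] [Nontrivial R] [Module.Finite R A]
    [Module.Free R A] [IsLocalRing S] [IsReduced S] [CharP S p] : Function.Injective f := by
  obtain ⟨u, hu, hker⟩ := hs.exists_forall_mem_ker hA hf
  have hum (i) : u i ∈ IsLocalRing.maximalIdeal S :=
    IsLocalRing.le_maximalIdeal (RingHom.ker_ne_top (f : S →+* A)) (hu i)
  have hu0 (i) : u i = 0 := eq_zero_of_pow_pow_eq_sum hum (fun i ↦ hker (u i) (hu i) 1) i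
  rw [injective_iff_map_eq_zero]
  intro x hx
  obtain ⟨m, r, hr⟩ := hker x hx 0
  refine eq_zero_of_pow_eq_zero (n := p ^ m) ?_
  simp [hr, hu0, (Fact.out : p.Prime).ne_zero]

theorem etale_of_algHom (hs : SpansPerfectClosure p R s) (hA : RelativeFrobeniusInjective p R A)
    (f : S →ₐ[R] A) [IsLocalRing R] [IsNoetherianRing R] [Nontrivial A] [CharP A p]
    [IsLocalRing S] [IsReduced S] [CharP S p] : Algebra.Etale R S := by
  have hB := hA.subalgebra f.range
  have hf := f.rangeRestrict_surjective
  have : CharP f.range p := f.range.val.toRingHom.charP Subtype.val_injective p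
  have := hs.finite hB hf
  have hpow := hs.span_range_pow_eq_top hB hf
  have := hB.free hpow
  have := hB.etale hpow
  exact .of_equiv (AlgEquiv.ofBijective f.rangeRestrict ⟨hs.injective hB hf, hf⟩).symm

end SpansPerfectClosure

/-! ### Perfect closures -/

section PerfectClosure

variable {p : ℕ} [Fact p.Prime] {A : Type*} [CommRing A] [CharP A p]

theorem perfectClosure_mk_pow_pow (n : ℕ) (a : A) :
    PerfectClosure.mk A p (n, a) ^ p ^ n = PerfectClosure.of A p a := by
  rw [← PerfectClosure.iterate_frobenius_mk, iterate_frobenius]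

theorem perfectClosure_of_injective [IsReduced A] :
    Function.Injective (PerfectClosure.of A p) := fun x y h ↦ by
  simpa using (PerfectClosure.eq_iff A p (0, x) (0, y)).1 h

theorem eventually_exists_of_eq_pow_pow {ι : Type*} [Finite ι] (x : ι → PerfectClosure A p) :
    ∀ᶠ m in Filter.atTop, ∃ a : ι → A, ∀ i, PerfectClosure.of A p (a i) = x i ^ p ^ m := by
  suffices h : ∀ i, ∀ᶠ m in Filter.atTop, ∃ a, PerfectClosure.of A p a = x i ^ p ^ m from
    (Filter.eventually_all.2 h).mono fun _ ↦ Classical.skolem.1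
  intro i
  obtain ⟨⟨n, a⟩, hx⟩ := PerfectClosure.mk_surjective A p (x i)
  filter_upwards [Filter.eventually_ge_atTop n] with m hm
  refine ⟨a ^ p ^ (m - n), ?_⟩
  rw [map_pow, ← perfectClosure_mk_pow_pow n, hx, ← pow_mul, ← pow_add, Nat.add_sub_cancel' hm]

theorem exists_spansPerfectClosure {R S : Type*} [CommRing R] [CharP R p] [CommRing S] [CharP S p]
    [IsReduced S] [Algebra R S] (h : (perfectClosureMap p R S).Finite) :
    ∃ (k : ℕ) (s : Fin k → S), SpansPerfectClosure p R s := by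
  algebraize [perfectClosureMap p R S]
  obtain ⟨k, g, hg⟩ := Module.Finite.exists_fin (R := PerfectClosure R p) (M := PerfectClosure S p)
  obtain ⟨e, s, hs⟩ := (eventually_exists_of_eq_pow_pow g).exists
  refine ⟨k, s, fun x n ↦ ?_⟩
  let y := PerfectClosure.mk S p (n + e, x)
  obtain ⟨ρ, hρ⟩ := (Submodule.mem_span_range_iff_exists_fun (PerfectClosure R p)).1
    (hg ▸ Submodule.mem_top : y ∈ Submodule.span (PerfectClosure R p) (Set.range g))
  obtain ⟨m, hm⟩ := Filter.eventually_atTop.1 (eventually_exists_of_eq_pow_pow ρ)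
  obtain ⟨r, hr⟩ := hm (n + e + m) (Nat.le_add_left _ _)
  refine ⟨m, r, perfectClosure_of_injective (p := p) ?_⟩
  calc PerfectClosure.of S p (x ^ p ^ m) = y ^ p ^ (n + e + m) := by
        rw [map_pow, ← perfectClosure_mk_pow_pow (n + e), ← pow_mul, ← pow_add]
    _ = ∑ i, perfectClosureMap p R S (ρ i ^ p ^ (n + e + m)) * g i ^ p ^ (e + (m + n)) := by
        rw [← hρ, sum_pow_char_pow, show e + (m + n) = n + e + m by omega]
        simp only [Algebra.smul_def, mul_pow, map_pow, RingHom.algebraMap_toAlgebra]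
    _ = ∑ i, PerfectClosure.of S p (algebraMap R S (r i)) *
          PerfectClosure.of S p (s i) ^ p ^ (m + n) := by
        simp only [← hr, hs, perfectClosureMap_of, ← pow_mul, ← pow_add]
    _ = PerfectClosure.of S p (∑ i, r i • s i ^ p ^ (m + n)) := by
        simp only [Algebra.smul_def, map_sum, map_mul, map_pow]

/-- The isomorphism `A ≃ A ^ (1 / p ^ n)` that takes `p ^ n`-th roots. It identifies
`rootRingMap p R S n` with `algebraMap R S`. -/
noncomputable def rootRingEquiv (p : ℕ) [Fact p.Prime] (A : Type*) [CommRing A] [CharP A p]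
    [IsReduced A] (n : ℕ) : A ≃+* rootRing p A n :=
  RingEquiv.ofBijective (RingHom.codRestrict
    ((iterateFrobeniusEquiv (PerfectClosure A p) p n).symm.toRingHom.comp (PerfectClosure.of A p))
    (rootRing p A n) fun a ↦ mem_rootRing.2 ⟨a, by
      simp [← iterateFrobeniusEquiv_apply, ← iterateFrobenius_def]⟩)
    ⟨fun _ _ h ↦ perfectClosure_of_injective
      ((iterateFrobeniusEquiv (PerfectClosure A p) p n).symm.injective (congrArg Subtype.val h)),
    fun y ↦ by
      obtain ⟨a, ha⟩ := mem_rootRing.1 y.2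
      exact ⟨a, Subtype.ext ((iterateFrobeniusEquiv (PerfectClosure A p) p n).symm_apply_eq.2 ha)⟩⟩

theorem rootRingEquiv_pow [IsReduced A] (n : ℕ) (a : A) :
    (rootRingEquiv p A n a : PerfectClosure A p) ^ p ^ n = PerfectClosure.of A p a :=
  (iterateFrobeniusEquiv (PerfectClosure A p) p n).apply_symm_apply _

variable {R S : Type*} [CommRing R] [CharP R p] [IsReduced R] [CommRing S] [CharP S p]
  [IsReduced S] [Algebra R S]

theorem rootRingMap_rootRingEquiv (n : ℕ) (r : R) :
    rootRingMap p R S n (rootRingEquiv p R n r) = rootRingEquiv p S n (algebraMap R S r) := by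
  refine Subtype.ext ((iterateFrobeniusEquiv (PerfectClosure S p) p n).injective ?_)
  change perfectClosureMap p R S (rootRingEquiv p R n r : PerfectClosure R p) ^ p ^ n =
    (rootRingEquiv p S n (algebraMap R S r) : PerfectClosure S p) ^ p ^ n
  rw [← map_pow, rootRingEquiv_pow, rootRingEquiv_pow, perfectClosureMap_of]

theorem ringHom_etale_comp {R S T : Type*} [CommRing R] [CommRing S] [CommRing T]
    {f : R →+* S} {g : S →+* T} (hg : g.Etale) (hf : f.Etale) : (g.comp f).Etale := by
  algebraize [f, g, g.comp f]
  exact Algebra.Etale.comp R S T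

theorem etale_rootRingMap [Algebra.Etale R S] (n : ℕ) : (rootRingMap p R S n).Etale := by
  have h : rootRingMap p R S n = ((rootRingEquiv p S n).toRingHom.comp (algebraMap R S)).comp
      (rootRingEquiv p R n).symm.toRingHom := by
    ext x
    obtain ⟨r, rfl⟩ := (rootRingEquiv p R n).surjective x
    simp [rootRingMap_rootRingEquiv]
  rw [h]
  exact ringHom_etale_comp (ringHom_etale_comp (.of_bijective (rootRingEquiv p S n).bijective)
    (RingHom.etale_algebraMap.2 inferInstance)) (.of_bijective (rootRingEquiv p R n).symm.bijective)

end PerfectClosure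

theorem exists_algHom_field_isSeparable_of_genericallyEtale.{u, v} {R : Type u} {S : Type v}
    [CommRing R] [IsDomain R] [CommRing S] [Algebra R S] (hgen : GenericallyEtale R S)
    (hne : Nontrivial (FractionRing R ⊗[R] S)) :
    ∃ (L : Type (max u v)) (_ : Field L) (_ : Algebra R L) (_ : Algebra (FractionRing R) L),
      IsScalarTower R (FractionRing R) L ∧ Algebra.IsSeparable (FractionRing R) L ∧
        Nonempty (S →ₐ[R] L) := by
  have : Algebra.Etale (FractionRing R) (FractionRing R ⊗[R] S) := hgen
  obtain ⟨M, hM⟩ := Ideal.exists_maximal (FractionRing R ⊗[R] S)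
  have : Algebra.FiniteType (FractionRing R) (FractionRing R ⊗[R] S ⧸ M) :=
    .of_surjective (Ideal.Quotient.mkₐ _ M) Ideal.Quotient.mk_surjective
  have : Algebra.FormallyUnramified (FractionRing R) (FractionRing R ⊗[R] S ⧸ M) :=
    .of_surjective (Ideal.Quotient.mkₐ _ M) Ideal.Quotient.mk_surjective
  let := Ideal.Quotient.field M
  exact ⟨FractionRing R ⊗[R] S ⧸ M, inferInstance, inferInstance, inferInstance, inferInstance,
    Algebra.FormallyUnramified.isSeparable _ _,
    ⟨(Ideal.Quotient.mkₐ R M).comp Algebra.TensorProduct.includeRight⟩⟩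

theorem corollary6p8_general (p : ℕ) [Fact p.Prime]
    (R : Type*) [CommRing R] [IsRegularLocalRing R] [CharP R p]
    (S : Type*) [CommRing S] [IsLocalRing S] [IsReduced S] [CharP S p] [Algebra R S]
    (K L : Type*) [Field K] [Algebra R K] [IsFractionRing R K] [Field L] [Algebra R L]
    [Algebra K L] [IsScalarTower R K L] [Algebra.IsSeparable K L] (f : S →ₐ[R] L)
    (hfin : (perfectClosureMap p R S).Finite) (n : ℕ) : (rootRingMap p R S n).Etale := by
  have := isDomain_of_isRegularLocalRing R
  have hL : RelativeFrobeniusInjective p R L :=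
    relativeFrobeniusInjective_of_isSeparable p (flat_frobenius R p) K L
  have : CharP K p := charP_of_injective_ringHom (IsFractionRing.injective R K) p
  have : CharP L p := charP_of_injective_ringHom (algebraMap K L).injective p
  obtain ⟨k, s, hs⟩ := exists_spansPerfectClosure hfin
  have : Algebra.Etale R S := hs.etale_of_algHom hL f
  exact etale_rootRingMap n

theorem corollary6p8 (p : ℕ) [Fact p.Prime]
    (R : Type*) [CommRing R] [IsRegularLocalRing R] [CharP R p]
    (S : Type*) [CommRing S] [IsLocalRing S] [IsReduced S] [CharP S p] [Algebra R S]
    (hgen : GenericallyEtale R S)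
    (hne : Nontrivial (FractionRing R ⊗[R] S))
    (hfin : (perfectClosureMap p R S).Finite) :
    ∃ N : ℕ, ∀ n : ℕ, N ≤ n → (rootRingMap p R S n).Etale := by
  have := isDomain_of_isRegularLocalRing R
  obtain ⟨L, _, _, _, _, _, ⟨f⟩⟩ := exists_algHom_field_isSeparable_of_genericallyEtale hgen hne
  exact ⟨0, fun n _ ↦ corollary6p8_general p R S (FractionRing R) L f hfin n⟩
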